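/- A template $G$ is a finite graph with vertex set $\mathcal V$, each vertex of which is labelled full or empty. Its infinite blow-up $G_\infty$ has vertex set $\{v_i: v\in\mathcal V,\ i\ge 1\}$; each blob $\mathcal W_v=\{v_i\}_{i\ge1}$ induces a complete graph if $v$ is full and an empty graph if $v$ is empty, and for distinct $v,w\in\mathcal V$ and all $i,j$, $v_iw_j$ is an edge of $G_\infty$ if and only if $vw$ is an edge of $G$. A random order on $G_\infty$ is a probability measure $\mathbb P$ on the set of total orders of its vertices, with the $\sigma$-algebra generated by the events $\{a<b\}$. It is consistent if $\mathbb P(x_1<\dots<x_k)=\mathbb P(\phi(x_1)<\dots<\phi(x_k))$ for every isomorphism $\phi:H_1\to H_2$ between finite induced subgraphs of $G_\infty$ and all vertices $x_1,\dots,x_k$ of $H_1$. It is uniform if it is the law of the order in which $a<b\iff X_a<X_b$, for i.i.d. random variables $X_a$, uniform on $[0,1]$, indexed by the vertices of $G_\infty$. Theorem. Let a consistent random order on $G_\infty$ be given. For $u,v\in\mathcal V$ and $i\ge1$ the limit $$V_{u,v_i}=\lim_{n\to\infty}\frac1n\sum_{k=1}^n \mathbf 1\{v_i>u_k\}$$ exists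 almost surely; and for $u,v\in\mathcal V$, almost surely, the limit $$F_{u,v}(x)=\lim_{n\to\infty}\frac1n\sum_{i=1}^n \mathbf 1\{V_{u,v_i}\le x\}$$ exists for every $x\in[0,1]$ and $F_{u,v}$ is a distribution function on $[0,1]$ (nonnegative, nondecreasing and right-continuous, with $F_{u,v}(1)=1$). Moreover, for any fixed $u\in\mathcal V$, the following are equivalent: (i) the random order on $G_\infty$ is uniform; (ii) the random variables $V_{u,v_i}$, $v\in\mathcal V$, $i\ge1$, are i.i.d. and uniform on $[0,1]$; (iii) for every $v\in\mathcal V$, almost surely $F_{u,v}(x)=x$ for all $x\in[0,1]$; (iii') for all $w,v\in\mathcal V$, almost surely $F_{w,v}(x)=x$ for all $x\in[0,1]$. -/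

import Mathlib

open MeasureTheory ProbabilityTheory Filter Topology
open scoped unitInterval

noncomputable section

/-- A template on the vertex set `V`: a graph, each vertex of which is labelled either full
(the members of `full`) or empty (the others). -/
structure Template (V : Type*) where
  /-- the underlying graph -/
  graph : SimpleGraph V
  /-- the set of vertices labelled full -/
  full : Set V

/-- The infinite blow-up of a template. The pair `(v, i)` is the `i`-th vertex of the blob of `v`
(indices start at `0`). A blob is complete or empty according to the label of `v`, and vertices of
distinct blobs are adjacent exactly when the template vertices are. -/
def Template.blowUp {V : Type*} (T : Template V) : SimpleGraph (V × ℕ) where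
  Adj p q := (p.1 = q.1 ∧ p.1 ∈ T.full ∧ p.2 ≠ q.2) ∨ T.graph.Adj p.1 q.1
  symm := ⟨by
    rintro p q (⟨h, hf, hn⟩ | h)
    · exact Or.inl ⟨h.symm, h ▸ hf, hn.symm⟩
    · exact Or.inr h.symm⟩
  loopless := ⟨by
    rintro p (⟨_, _, hn⟩ | h)
    · exact hn rfl
    · exact T.graph.loopless.irrefl _ h⟩

/-- A total ordering of `α`, recorded by its strict order relation. -/
structure TotalOrdering (α : Type*) where
  /-- the strict order relation -/
  lt : α → α → Prop
  isTotal : IsStrictTotalOrder α lt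

/-- The σ-algebra generated by all events `a < b`. -/
instance TotalOrdering.measurableSpace (α : Type*) : MeasurableSpace (TotalOrdering α) :=
  MeasurableSpace.generateFrom {s | ∃ a b : α, s = {o | o.lt a b}}

/-- The event `x 0 < x 1 < ⋯ < x (k - 1)`. -/
def chainEvent {α : Type*} {k : ℕ} (x : Fin k → α) : Set (TotalOrdering α) :=
  {o | ∀ i j : Fin k, i < j → o.lt (x i) (x j)}

/-- A distribution on the orderings of the vertices of `G` is consistent if every isomorphism
between finite induced subgraphs preserves the probabilities of all events `x₁ < ⋯ < xₖ`. -/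
def IsConsistent {α : Type*} (G : SimpleGraph α) (P : Measure (TotalOrdering α)) : Prop :=
  ∀ (S₁ S₂ : Set α), S₁.Finite → S₂.Finite → ∀ (φ : G.induce S₁ ≃g G.induce S₂),
    ∀ (k : ℕ) (x : Fin k → S₁),
      P (chainEvent fun i => (x i : α)) = P (chainEvent fun i => (φ (x i) : α))

/-- The ordering of `α` by the values of `x : α → [0,1]`. Ties are broken by a fixed well-order of
`α`, which only serves to make the ordering defined for every `x`: for countable `α` and i.i.d.
uniform values, ties have probability `0`. -/
def orderingOfValues {α : Type*} (x : α → I) : TotalOrdering α where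
  lt a b := x a < x b ∨ (x a = x b ∧ WellOrderingRel a b)
  isTotal :=
    { trichotomous := by
        intro a b hab hba
        push Not at hab hba
        have h : x a = x b := le_antisymm hba.1 hab.1
        rcases trichotomous_of (WellOrderingRel (α := α)) a b with h' | h' | h'
        · exact absurd h' (hab.2 h)
        · exact h'
        · exact absurd h' (hba.2 h.symm)
      irrefl := by
        rintro a (h | ⟨_, h⟩)
        · exact lt_irrefl _ h
        · exact irrefl_of WellOrderingRel a h
      trans := by
        rintro a b c (h | ⟨h, h'⟩) (g | ⟨g, g'⟩)
        · exact Or.inl (h.trans g)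
        · exact Or.inl (g ▸ h)
        · exact Or.inl (h ▸ g)
        · exact Or.inr ⟨h.trans g, trans_of WellOrderingRel h' g'⟩ }

theorem measurable_orderingOfValues {α : Type*} :
    Measurable (orderingOfValues : (α → I) → TotalOrdering α) := by
  refine measurable_generateFrom ?_
  rintro _ ⟨a, b, rfl⟩
  have h : orderingOfValues ⁻¹' {o : TotalOrdering α | o.lt a b}
      = {x : α → I | x a < x b} ∪ ({x : α → I | x a = x b} ∩ {_x | WellOrderingRel a b}) := rfl
  rw [h]
  exact (measurableSet_lt (measurable_pi_apply a) (measurable_pi_apply b)).union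
    ((measurableSet_eq_fun (measurable_pi_apply a) (measurable_pi_apply b)).inter
      (MeasurableSet.const _))

/-- The uniform random ordering of `α`: the vertices are ordered by i.i.d. uniform random
variables. -/
def uniformOrdering (α : Type*) : Measure (TotalOrdering α) :=
  (Measure.infinitePi fun _ : α => (volume : Measure I)).map orderingOfValues

/-- The proportion of the first `n` natural numbers that lie in `s`. -/
def proportion (s : Set ℕ) (n : ℕ) : ℝ :=
  (∑ k ∈ Finset.range n, s.indicator (fun _ => (1 : ℝ)) k) / n

/-- The rank variable `V_{u,p}` of the vertex `p` of the blow-up: the limiting proportion of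
vertices of the blob of `u` that `p` exceeds. -/
def rankVar {V : Type*} (u : V) (p : V × ℕ) (o : TotalOrdering (V × ℕ)) : ℝ :=
  limUnder atTop (proportion {k | o.lt (u, k) p})

/-- The random distribution function `F_{u,v}`: the limiting empirical distribution function of
`V_{u,v_1}, V_{u,v_2}, …`. -/
def rankCDF {V : Type*} (u v : V) (o : TotalOrdering (V × ℕ)) (x : ℝ) : ℝ :=
  limUnder atTop (proportion {i | rankVar u (v, i) o ≤ x})

/-- `F` is, on `[0,1]`, the distribution function of a probability measure on `[0,1]`. -/
structure IsUnitCDF (F : ℝ → ℝ) : Prop where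
  nonneg : 0 ≤ F 0
  mono : MonotoneOn F (Set.Icc 0 1)
  rightCts : ∀ x ∈ Set.Ico (0 : ℝ) 1, ContinuousWithinAt F (Set.Icc x 1) x
  one : F 1 = 1

end

/-! Permuting the vertices of one blob is an automorphism of the blow-up, so a consistent ordering
is invariant in law under such permutations. Existence of `V`: for a fixed vertex `p`, the events
that `p` exceeds `u_k` have constant first and pairwise joint probabilities. A law of large numbers
that uses only these second moments (`ae_exists_tendsto_proportion`) makes their frequencies
converge. Existence of `F`: restricted to the blob of `v`, the ordering has `k!` equally likely
patterns on any `k` vertices, hence is uniform there, and the ranks of `v_i` within its own blob are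
equidistributed. `V_{u,v_i}` is a nondecreasing function of that rank, so its sublevel sets are
initial segments up to a boundary of density zero and have densities for all levels at once
(`IsEquidistributed.isUnitCDF`). Equivalences: under the uniform ordering, `V_{u,p}` is the value
`X_p` and the strong law gives (iii'). If the empirical limits are deterministic, replacing `v_i` by
fresh vertices `v_k` and averaging over `k` splits one factor off the joint distribution function
(`measureReal_iInter_rankVar_le`), so (iii) gives (ii). Finally, the ordering is weakly monotone in
the ranks, and i.i.d. uniform ranks almost surely have no ties, so the ranks recover the ordering
and (ii) gives (i). -/

/-! ### Densities of sets of natural numbers. -/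

theorem proportion_mono {s t : Set ℕ} (h : s ⊆ t) (n : ℕ) : proportion s n ≤ proportion t n := by
  unfold proportion
  gcongr

theorem proportion_nonneg (s : Set ℕ) (n : ℕ) : 0 ≤ proportion s n :=
  div_nonneg (Finset.sum_nonneg fun _ _ => Set.indicator_nonneg (fun _ _ => zero_le_one) _)
    n.cast_nonneg

theorem proportion_le_one (s : Set ℕ) (n : ℕ) : proportion s n ≤ 1 := by
  refine div_le_one_of_le₀ ?_ n.cast_nonneg
  calc ∑ k ∈ Finset.range n, s.indicator (fun _ => (1 : ℝ)) k
      ≤ ∑ _k ∈ Finset.range n, (1 : ℝ) :=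
        Finset.sum_le_sum fun _ _ => Set.indicator_le_self' (fun _ _ => zero_le_one) _
    _ = n := by simp

theorem tendsto_proportion_empty : Tendsto (proportion ∅) atTop (𝓝 0) := by
  have : proportion ∅ = fun _ => 0 := by
    ext n
    simp [proportion]
  rw [this]
  exact tendsto_const_nhds

theorem tendsto_proportion_univ : Tendsto (proportion Set.univ) atTop (𝓝 1) := by
  refine tendsto_const_nhds.congr' ?_
  filter_upwards [eventually_gt_atTop 0] with n hn
  have : (n : ℝ) ≠ 0 := by positivity
  simp [proportion, this]

theorem limit_proportion_mem_Icc {s : Set ℕ} {l : ℝ} (h : Tendsto (proportion s) atTop (𝓝 l)) :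
    l ∈ Set.Icc (0 : ℝ) 1 :=
  ⟨ge_of_tendsto' h (proportion_nonneg s), le_of_tendsto' h (proportion_le_one s)⟩

/-- A set that is squeezed between sets with densities arbitrarily close to `l` has density `l`. -/
theorem tendsto_proportion_of_squeeze {s : Set ℕ} {l : ℝ}
    (hlow : ∀ c < l, ∃ t ⊆ s, ∃ a > c, Tendsto (proportion t) atTop (𝓝 a))
    (hupp : ∀ c > l, ∃ t, s ⊆ t ∧ ∃ a < c, Tendsto (proportion t) atTop (𝓝 a)) :
    Tendsto (proportion s) atTop (𝓝 l) := by
  refine tendsto_order.2 ⟨fun c hc => ?_, fun c hc => ?_⟩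
  · obtain ⟨t, hts, a, hca, ht⟩ := hlow c hc
    filter_upwards [ht.eventually_const_lt hca] with n hn
    exact hn.trans_le (proportion_mono hts n)
  · obtain ⟨t, hst, a, hac, ht⟩ := hupp c hc
    filter_upwards [ht.eventually_lt_const hac] with n hn
    exact (proportion_mono hst n).trans_lt hn

theorem tendsto_proportion_of_shift {s : Set ℕ} {l : ℝ} (N : ℕ)
    (h : Tendsto (proportion {k | N + k ∈ s}) atTop (𝓝 l)) :
    Tendsto (proportion s) atTop (𝓝 l) := by
  rw [← tendsto_add_atTop_iff_nat N]
  have h1 : Tendsto (fun n : ℕ => (n : ℝ) / (n + N : ℕ)) atTop (𝓝 1) := by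
    simpa using tendsto_natCast_div_add_atTop (𝕜 := ℝ) (N : ℝ)
  have h2 : Tendsto (fun n : ℕ => (∑ k ∈ Finset.range N, s.indicator (fun _ => (1 : ℝ)) k)
      / ((n + N : ℕ) : ℝ)) atTop (𝓝 0) :=
    tendsto_const_nhds.div_atTop
      (tendsto_natCast_atTop_atTop.comp (tendsto_add_atTop_nat N))
  have h3 := h2.add (h1.mul h)
  rw [zero_add, one_mul] at h3
  refine h3.congr' ?_
  filter_upwards [eventually_gt_atTop 0] with n hn
  have hn' : (n : ℝ) ≠ 0 := by positivity
  have hnN : ((n + N : ℕ) : ℝ) ≠ 0 := by positivity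
  have hs : ∑ k ∈ Finset.range n, ({k | N + k ∈ s} : Set ℕ).indicator (fun _ => (1 : ℝ)) k
      = ∑ k ∈ Finset.range n, s.indicator (fun _ => (1 : ℝ)) (N + k) := rfl
  unfold proportion
  rw [hs, add_comm n N, Finset.sum_range_add]
  rw [add_comm n N] at hnN
  field_simp

/-! ### Equidistributed sequences and monotone functions of them. -/

/-- A sequence of real numbers is equidistributed in `[0,1]` if its empirical distribution
functions converge to that of the uniform distribution. -/
def IsEquidistributed (r : ℕ → ℝ) : Prop :=
  ∀ x ∈ Set.Icc (0 : ℝ) 1, Tendsto (proportion {i | r i ≤ x}) atTop (𝓝 x)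

/-- Countably many thresholds suffice because the limit is continuous in `x`; this serves both
almost sure statements and measurability. -/
theorem isEquidistributed_of_rat {r : ℕ → ℝ}
    (h : ∀ q : ℚ, (q : ℝ) ∈ Set.Icc (0 : ℝ) 1 → Tendsto (proportion {i | r i ≤ q}) atTop (𝓝 q)) :
    IsEquidistributed r := by
  intro x hx
  refine tendsto_proportion_of_squeeze (fun c hc => ?_) (fun c hc => ?_)
  · rcases lt_or_ge c 0 with hc0 | hc0
    · exact ⟨∅, Set.empty_subset _, 0, hc0, tendsto_proportion_empty⟩
    · obtain ⟨q, hcq, hqx⟩ := exists_rat_btwn hc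
      exact ⟨_, fun i (hi : r i ≤ q) => hi.trans hqx.le, q, hcq,
        h q ⟨hc0.trans hcq.le, hqx.le.trans hx.2⟩⟩
  · rcases lt_or_ge 1 c with hc1 | hc1
    · exact ⟨Set.univ, Set.subset_univ _, 1, hc1, tendsto_proportion_univ⟩
    · obtain ⟨q, hxq, hqc⟩ := exists_rat_btwn hc
      exact ⟨_, fun i (hi : r i ≤ x) => hi.trans hxq.le, q, hqc,
        h q ⟨hx.1.trans hxq.le, hqc.le.trans hc1⟩⟩

namespace IsEquidistributed

variable {r : ℕ → ℝ}

theorem tendsto_of_subset (hr : IsEquidistributed r) {s : Set ℕ} {x : ℝ}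
    (hx : x ∈ Set.Icc (0 : ℝ) 1) (h₁ : {i | r i < x} ⊆ s) (h₂ : s ⊆ {i | r i ≤ x}) :
    Tendsto (proportion s) atTop (𝓝 x) := by
  refine tendsto_proportion_of_squeeze (fun c hc => ?_) (fun c hc => ⟨_, h₂, x, hc, hr x hx⟩)
  rcases lt_or_ge c 0 with hc0 | hc0
  · exact ⟨∅, Set.empty_subset _, 0, hc0, tendsto_proportion_empty⟩
  · obtain ⟨y, hcy, hyx⟩ := exists_between hc
    exact ⟨_, fun i (hi : r i ≤ y) => h₁ (hi.trans_lt hyx), y, hcy,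
      hr y ⟨hc0.trans hcy.le, hyx.le.trans hx.2⟩⟩

theorem exists_mem_Ioo (hr : IsEquidistributed r) {a b : ℝ} (ha : 0 ≤ a) (hab : a < b)
    (hb : b ≤ 1) : ∃ i, a < r i ∧ r i < b := by
  by_contra! h
  have h1 := hr a ⟨ha, hab.le.trans hb⟩
  have h2 : Tendsto (proportion {i | r i < b}) atTop (𝓝 b) :=
    hr.tendsto_of_subset ⟨ha.trans hab.le, hb⟩ subset_rfl fun i (hi : r i < b) => hi.le
  refine hab.not_ge (le_of_tendsto_of_tendsto' h2 h1 fun n => proportion_mono ?_ n)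
  intro i (hi : r i < b)
  by_contra hai
  exact (h i (not_le.1 hai)).not_gt hi

/-- If `W` is a nondecreasing function of an equidistributed sequence in `[0,1]`, then the
empirical distribution functions of `W` converge everywhere, and the limit is a distribution
function. -/
theorem isUnitCDF (hr : IsEquidistributed r) (hr0 : ∀ i, r i ∈ Set.Icc (0 : ℝ) 1) {W : ℕ → ℝ}
    (hW : ∀ i, W i ≤ 1) (hrW : ∀ i j, r i < r j → W i ≤ W j) :
    IsUnitCDF (fun x => limUnder atTop (proportion {i | W i ≤ x})) ∧
    ∀ x ∈ Set.Icc (0 : ℝ) 1, Tendsto (proportion {i | W i ≤ x}) atTop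
      (𝓝 (limUnder atTop (proportion {i | W i ≤ x}))) := by
  set F : ℝ → ℝ := fun x => limUnder atTop (proportion {i | W i ≤ x}) with hF
  -- The threshold `ρ` is the supremum of the `r i` with `W i ≤ x`; inserting `0` covers the case
  -- where there are none.
  have key : ∀ x, ∃ ρ ∈ Set.Icc (0 : ℝ) 1, {i | r i < ρ} ⊆ {i | W i ≤ x} ∧
      {i | W i ≤ x} ⊆ {i | r i ≤ ρ} := by
    intro x
    have hbdd : BddAbove (insert 0 (r '' {i | W i ≤ x})) := by
      refine ⟨1, ?_⟩
      rintro _ (rfl | ⟨i, -, rfl⟩)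
      · exact zero_le_one
      · exact (hr0 i).2
    refine ⟨sSup (insert 0 (r '' {i | W i ≤ x})), ⟨le_csSup hbdd (Set.mem_insert _ _),
      csSup_le (Set.insert_nonempty _ _) ?_⟩, ?_, fun i hi => ?_⟩
    · rintro _ (rfl | ⟨i, -, rfl⟩)
      · exact zero_le_one
      · exact (hr0 i).2
    · intro i hi
      obtain ⟨y, hy, hiy⟩ := exists_lt_of_lt_csSup (Set.insert_nonempty _ _) (Set.mem_ofPred.1 hi)
      rcases hy with rfl | ⟨j, hj, rfl⟩
      · exact absurd hiy (hr0 i).1.not_gt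
      · exact (hrW i j hiy).trans hj
    · exact le_csSup hbdd (Set.mem_insert_of_mem _ ⟨i, hi, rfl⟩)
  have hlim : ∀ x, Tendsto (proportion {i | W i ≤ x}) atTop (𝓝 (F x)) := by
    intro x
    obtain ⟨ρ, hρ, h1, h2⟩ := key x
    exact tendsto_nhds_limUnder ⟨ρ, hr.tendsto_of_subset hρ h1 h2⟩
  -- The threshold is the density `F x` itself.
  have hFsub : ∀ x, {i | r i < F x} ⊆ {i | W i ≤ x} ∧ {i | W i ≤ x} ⊆ {i | r i ≤ F x} := by
    intro x
    obtain ⟨ρ, hρ, h1, h2⟩ := key x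
    rw [tendsto_nhds_unique (hlim x) (hr.tendsto_of_subset hρ h1 h2)]
    exact ⟨h1, h2⟩
  have hmono : Monotone F := fun x y hxy =>
    le_of_tendsto_of_tendsto' (hlim x) (hlim y) fun n =>
      proportion_mono (fun i (hi : W i ≤ x) => hi.trans hxy) n
  refine ⟨⟨(limit_proportion_mem_Icc (hlim 0)).1, hmono.monotoneOn _, ?_, ?_⟩, fun x _ => hlim x⟩
  · intro x _
    refine tendsto_order.2 ⟨fun c hc => ?_, fun c hc => ?_⟩
    · filter_upwards [self_mem_nhdsWithin] with y hy
      exact hc.trans_le (hmono hy.1)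
    · rcases (limit_proportion_mem_Icc (hlim x)).2.lt_or_eq with hx1 | hx1
      -- Some `r i` lies strictly between `F x` and `c`. Then `x < W i`, and `F ≤ r i < c` at every
      -- point below `W i`.
      · obtain ⟨i, hi1, hi2⟩ := hr.exists_mem_Ioo (limit_proportion_mem_Icc (hlim x)).1
          (lt_min hx1 hc) (min_le_left 1 c)
        have hxi : x < W i := by
          by_contra hxi
          exact hi1.not_ge ((hFsub x).2 (not_lt.1 hxi))
        filter_upwards [mem_nhdsWithin_of_mem_nhds (Iio_mem_nhds hxi)] with y hy
        have : F y ≤ r i := by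
          by_contra hy'
          exact (show y < W i from hy).not_ge ((hFsub y).1 (not_le.1 hy'))
        exact this.trans_lt (hi2.trans_le (min_le_right _ _))
      · filter_upwards with y
        exact (limit_proportion_mem_Icc (hlim y)).2.trans_lt (hx1 ▸ hc)
  · refine tendsto_nhds_unique (hlim 1) ?_
    have : {i | W i ≤ 1} = Set.univ := Set.eq_univ_of_forall hW
    rw [this]
    exact tendsto_proportion_univ

end IsEquidistributed

/-! ### A law of large numbers from constant second moments. -/

theorem proportion_eq_sum_indicator {Ω : Type*} (E : ℕ → Set Ω) (n : ℕ) (ω : Ω) :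
    proportion {k | ω ∈ E k} n
      = (∑ k ∈ Finset.range n, (E k).indicator (fun _ => (1 : ℝ)) ω) / n := rfl

section SecondMoment

variable {Ω : Type*} [MeasurableSpace Ω] {μ : Measure Ω} [IsProbabilityMeasure μ]
  {E : ℕ → Set Ω} {c d : ℝ}

theorem measurable_proportion (hE : ∀ k, MeasurableSet (E k)) (n : ℕ) :
    Measurable fun ω => proportion {k | ω ∈ E k} n := by
  simp only [proportion_eq_sum_indicator]
  exact (Finset.measurable_sum _ fun k _ => measurable_const.indicator (hE k)).div_const _

theorem integrable_proportion_mul (hE : ∀ k, MeasurableSet (E k)) (m n : ℕ) :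
    Integrable (fun ω => proportion {k | ω ∈ E k} m * proportion {k | ω ∈ E k} n) μ := by
  refine Integrable.of_bound
    ((measurable_proportion hE m).mul (measurable_proportion hE n)).aestronglyMeasurable 1
    (ae_of_all _ fun ω => ?_)
  rw [Real.norm_of_nonneg (mul_nonneg (proportion_nonneg _ _) (proportion_nonneg _ _))]
  exact mul_le_one₀ (proportion_le_one _ _) (proportion_nonneg _ _) (proportion_le_one _ _)

/-- Among the `m * n` index pairs exactly `m` are diagonal, since `m ≤ n`; each of these contributes
`d` instead of `c`. -/
theorem integral_proportion_mul (hE : ∀ k, MeasurableSet (E k))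
    (hc : ∀ i j, i ≠ j → μ.real (E i ∩ E j) = c) (hd : ∀ i, μ.real (E i) = d)
    {m n : ℕ} (hm : 0 < m) (hmn : m ≤ n) :
    ∫ ω, proportion {k | ω ∈ E k} m * proportion {k | ω ∈ E k} n ∂μ = c + (d - c) / n := by
  have h1 : ∀ i j, μ.real (E i ∩ E j) = c + if i = j then d - c else 0 := by
    intro i j
    split_ifs with h
    · rw [h, Set.inter_self, hd]
      ring
    · rw [hc i j h, add_zero]
  have h2 : ∀ ω, proportion {k | ω ∈ E k} m * proportion {k | ω ∈ E k} n
      = (∑ i ∈ Finset.range m, ∑ j ∈ Finset.range n,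
        (E i ∩ E j).indicator (fun _ => (1 : ℝ)) ω) / (m * n) := by
    intro ω
    rw [proportion_eq_sum_indicator, proportion_eq_sum_indicator, div_mul_div_comm,
      Finset.sum_mul_sum]
    congr 1
    refine Finset.sum_congr rfl fun i _ => Finset.sum_congr rfl fun j _ => ?_
    rw [← Set.indicator_indicator]
    by_cases h : ω ∈ E i <;> simp [h]
  have hint : ∀ i j, Integrable ((E i ∩ E j).indicator fun _ => (1 : ℝ)) μ := fun i j =>
    (integrable_const 1).indicator ((hE i).inter (hE j))
  have hm' : (m : ℝ) ≠ 0 := by positivity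
  have hn' : (n : ℝ) ≠ 0 := by
    have := hm.trans_le hmn
    positivity
  simp_rw [h2]
  rw [integral_div, integral_finsetSum _ fun i _ => integrable_finsetSum _ fun j _ => hint i j]
  have h3 : ∀ i ∈ Finset.range m,
      ∫ ω, ∑ j ∈ Finset.range n, (E i ∩ E j).indicator (fun _ => (1 : ℝ)) ω ∂μ
        = n * c + (d - c) := by
    intro i hi
    have hin : i < n := (Finset.mem_range.1 hi).trans_le hmn
    rw [integral_finsetSum _ fun j _ => hint i j]
    have h4 : ∀ j, ∫ ω, (E i ∩ E j).indicator (fun _ => (1 : ℝ)) ω ∂μ = μ.real (E i ∩ E j) :=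
      fun j => integral_indicator_one ((hE i).inter (hE j))
    simp_rw [h4, h1]
    rw [Finset.sum_add_distrib, Finset.sum_ite_eq]
    simp [hin]
  rw [Finset.sum_congr rfl h3]
  simp only [Finset.sum_const, Finset.card_range, nsmul_eq_mul]
  field_simp

/-- The mean square difference of the averages at times `m ≤ n` is `(d - c) * (1 / m - 1 / n)`.
Between consecutive cubes this is of order `k⁻⁴`, whose square root is summable. -/
theorem integral_abs_proportion_sub_le (hE : ∀ k, MeasurableSet (E k))
    (hc : ∀ i j, i ≠ j → μ.real (E i ∩ E j) = c) (hd : ∀ i, μ.real (E i) = d) (k : ℕ) :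
    ∫ ω, |proportion {k | ω ∈ E k} ((k + 2) ^ 3) - proportion {k | ω ∈ E k} ((k + 1) ^ 3)| ∂μ
      ≤ 2 / ((k : ℝ) + 1) ^ 2 := by
  set A : ℕ → Ω → ℝ := fun n ω => proportion {k | ω ∈ E k} n with hA
  set a : ℝ := (k : ℝ) + 1 with ha
  have ha0 : 0 < a := by positivity
  have ha1 : 1 ≤ a := by
    have : (0 : ℝ) ≤ k := k.cast_nonneg
    linarith
  have hdc : d - c ≤ 1 := by
    have h1 : d ≤ 1 := hd 0 ▸ measureReal_le_one
    have h2 : 0 ≤ c := hc 0 1 zero_ne_one ▸ measureReal_nonneg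
    linarith
  have hle : (k + 1) ^ 3 ≤ (k + 2) ^ 3 := by gcongr; norm_num
  have hk1 : (((k + 1) ^ 3 : ℕ) : ℝ) = a ^ 3 := by push_cast; rfl
  have hk2 : (((k + 2) ^ 3 : ℕ) : ℝ) = (a + 1) ^ 3 := by
    push_cast
    rw [ha]
    ring
  have i1 : Integrable (fun ω => A ((k + 2) ^ 3) ω * A ((k + 2) ^ 3) ω) μ :=
    integrable_proportion_mul hE _ _
  have i2 : Integrable (fun ω => A ((k + 1) ^ 3) ω * A ((k + 2) ^ 3) ω) μ :=
    integrable_proportion_mul hE _ _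
  have i3 : Integrable (fun ω => A ((k + 1) ^ 3) ω * A ((k + 1) ^ 3) ω) μ :=
    integrable_proportion_mul hE _ _
  have hsq : ∀ ω, (A ((k + 2) ^ 3) ω - A ((k + 1) ^ 3) ω) ^ 2
      = (A ((k + 2) ^ 3) ω * A ((k + 2) ^ 3) ω - 2 * (A ((k + 1) ^ 3) ω * A ((k + 2) ^ 3) ω))
        + A ((k + 1) ^ 3) ω * A ((k + 1) ^ 3) ω := fun ω => by ring
  have isq : Integrable (fun ω => (A ((k + 2) ^ 3) ω - A ((k + 1) ^ 3) ω) ^ 2) μ := by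
    simp_rw [hsq]
    exact (i1.sub (i2.const_mul 2)).add i3
  have hint : ∫ ω, (A ((k + 2) ^ 3) ω - A ((k + 1) ^ 3) ω) ^ 2 ∂μ
      = (d - c) * (1 / a ^ 3 - 1 / (a + 1) ^ 3) := by
    simp_rw [hsq]
    rw [integral_add (f := fun ω => A ((k + 2) ^ 3) ω * A ((k + 2) ^ 3) ω
        - 2 * (A ((k + 1) ^ 3) ω * A ((k + 2) ^ 3) ω)) (i1.sub (i2.const_mul 2)) i3,
      integral_sub i1 (i2.const_mul 2), integral_const_mul,
      integral_proportion_mul hE hc hd (by positivity) le_rfl,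
      integral_proportion_mul hE hc hd (by positivity) hle,
      integral_proportion_mul hE hc hd (by positivity) le_rfl, hk1, hk2]
    ring
  have hbound : ∫ ω, (A ((k + 2) ^ 3) ω - A ((k + 1) ^ 3) ω) ^ 2 ∂μ ≤ 3 / a ^ 4 := by
    have h0 : 1 / a ^ 3 - 1 / (a + 1) ^ 3 ≤ 3 / a ^ 4 := by
      rw [sub_le_iff_le_add, div_add_div _ _ (by positivity) (by positivity),
        div_le_div_iff₀ (by positivity) (by positivity)]
      have : 0 < a ^ 3 := by positivity
      nlinarith [sq_nonneg a, mul_pos this ha0, mul_pos this (pow_pos ha0 2),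
        mul_pos this (pow_pos ha0 3), mul_pos this (pow_pos ha0 4)]
    have h1 : 0 ≤ 1 / a ^ 3 - 1 / (a + 1) ^ 3 := by
      rw [sub_nonneg]
      gcongr
      linarith
    rw [hint]
    calc (d - c) * (1 / a ^ 3 - 1 / (a + 1) ^ 3) ≤ 1 * (1 / a ^ 3 - 1 / (a + 1) ^ 3) := by gcongr
      _ ≤ 3 / a ^ 4 := by rwa [one_mul]
  -- AM-GM, weighted so that both terms have integral of order `a⁻²`.
  have hpt : ∀ ω, |A ((k + 2) ^ 3) ω - A ((k + 1) ^ 3) ω|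
      ≤ a ^ 2 / 2 * (A ((k + 2) ^ 3) ω - A ((k + 1) ^ 3) ω) ^ 2 + 1 / (2 * a ^ 2) := by
    intro ω
    have h0 := sq_nonneg (a ^ 2 * |A ((k + 2) ^ 3) ω - A ((k + 1) ^ 3) ω| - 1)
    rw [← sq_abs (A ((k + 2) ^ 3) ω - A ((k + 1) ^ 3) ω)]
    have : a ^ 2 / 2 * |A ((k + 2) ^ 3) ω - A ((k + 1) ^ 3) ω| ^ 2 + 1 / (2 * a ^ 2)
        - |A ((k + 2) ^ 3) ω - A ((k + 1) ^ 3) ω|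
        = (a ^ 2 * |A ((k + 2) ^ 3) ω - A ((k + 1) ^ 3) ω| - 1) ^ 2 / (2 * a ^ 2) := by
      field_simp
      ring
    have h2 : 0 ≤ (a ^ 2 * |A ((k + 2) ^ 3) ω - A ((k + 1) ^ 3) ω| - 1) ^ 2 / (2 * a ^ 2) := by
      positivity
    linarith
  calc ∫ ω, |A ((k + 2) ^ 3) ω - A ((k + 1) ^ 3) ω| ∂μ
      ≤ ∫ ω, (a ^ 2 / 2 * (A ((k + 2) ^ 3) ω - A ((k + 1) ^ 3) ω) ^ 2 + 1 / (2 * a ^ 2)) ∂μ :=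
        integral_mono_of_nonneg (ae_of_all _ fun _ => abs_nonneg _)
          ((isq.const_mul _).add (integrable_const _)) (ae_of_all _ hpt)
    _ = a ^ 2 / 2 * ∫ ω, (A ((k + 2) ^ 3) ω - A ((k + 1) ^ 3) ω) ^ 2 ∂μ + 1 / (2 * a ^ 2) := by
        rw [integral_add (isq.const_mul _) (integrable_const _), integral_const_mul]
        simp
    _ ≤ a ^ 2 / 2 * (3 / a ^ 4) + 1 / (2 * a ^ 2) := by gcongr
    _ = 2 / a ^ 2 := by
        field_simp
        norm_num

/-- If the probabilities of the events `E i` and of their pairwise intersections do not depend on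
the indices, then almost surely the proportion of the events that occur converges. -/
theorem ae_exists_tendsto_proportion (hE : ∀ k, MeasurableSet (E k))
    (hc : ∀ i j, i ≠ j → μ.real (E i ∩ E j) = c) (hd : ∀ i, μ.real (E i) = d) :
    ∀ᵐ ω ∂μ, ∃ l, Tendsto (proportion {k | ω ∈ E k}) atTop (𝓝 l) := by
  set D : ℕ → Ω → ℝ := fun k ω =>
    proportion {k | ω ∈ E k} ((k + 2) ^ 3) - proportion {k | ω ∈ E k} ((k + 1) ^ 3) with hD
  have hDm : ∀ k, Measurable (D k) := fun k =>
    (measurable_proportion hE _).sub (measurable_proportion hE _)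
  have hDint : ∀ k, Integrable (D k) μ := by
    intro k
    refine Integrable.of_bound (hDm k).aestronglyMeasurable 1 (ae_of_all _ fun ω => ?_)
    rw [Real.norm_eq_abs, abs_sub_le_iff]
    have h1 := proportion_le_one {k | ω ∈ E k} ((k + 2) ^ 3)
    have h2 := proportion_le_one {k | ω ∈ E k} ((k + 1) ^ 3)
    have h3 := proportion_nonneg {k | ω ∈ E k} ((k + 2) ^ 3)
    have h4 := proportion_nonneg {k | ω ∈ E k} ((k + 1) ^ 3)
    constructor <;> linarith
  have hsum : Summable fun k : ℕ => 2 / ((k : ℝ) + 1) ^ 2 := by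
    have h : Summable fun k : ℕ => 1 / (((k + 1 : ℕ) : ℝ)) ^ 2 :=
      (summable_nat_add_iff 1).2 (Real.summable_one_div_nat_pow.2 one_lt_two)
    refine (h.mul_left 2).congr fun k => ?_
    push_cast
    ring
  have hfin : ∫⁻ ω, ∑' k, ‖D k ω‖ₑ ∂μ ≠ ⊤ := by
    rw [lintegral_tsum fun k => (hDm k).enorm.aemeasurable]
    have h1 : ∀ k, ∫⁻ ω, ‖D k ω‖ₑ ∂μ ≤ ENNReal.ofReal (2 / ((k : ℝ) + 1) ^ 2) := by
      intro k
      rw [← ofReal_integral_norm_eq_lintegral_enorm (hDint k)]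
      exact ENNReal.ofReal_le_ofReal (integral_abs_proportion_sub_le hE hc hd k)
    exact ((ENNReal.tsum_le_tsum h1).trans_lt hsum.tsum_ofReal_lt_top).ne
  filter_upwards [ae_lt_top (Measurable.tsum fun k => (hDm k).enorm) hfin] with ω hω
  have hs : Summable fun k => ‖D k ω‖ := by
    refine ENNReal.summable_toReal hω.ne |>.congr fun k => ?_
    simp
  have hcauchy : CauchySeq fun k : ℕ => proportion {k | ω ∈ E k} ((k + 1) ^ 3) := by
    refine cauchySeq_of_summable_dist (hs.congr fun k => ?_)
    rw [dist_comm, Real.dist_eq, Real.norm_eq_abs]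
  obtain ⟨l, hl⟩ := cauchySeq_tendsto_of_complete hcauchy
  -- The partial sums are monotone and ratios of consecutive cubes tend to `1`, so convergence along
  -- cubes gives convergence.
  refine ⟨l, tendsto_div_of_monotone_of_exists_subseq_tendsto_div _ l ?_ fun a ha =>
    ⟨fun k => (k + 1) ^ 3, ?_, ?_, hl⟩⟩
  · refine monotone_nat_of_le_succ fun n => ?_
    rw [Finset.sum_range_succ]
    exact le_add_of_nonneg_right (Set.indicator_nonneg (fun _ _ => zero_le_one) _)
  · have h1 : Tendsto (fun n : ℕ => (1 + 1 / ((n : ℝ) + 1)) ^ 3) atTop (𝓝 1) := by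
      have := (tendsto_one_div_add_atTop_nhds_zero_nat (𝕜 := ℝ)).const_add 1
      simpa using this.pow 3
    filter_upwards [h1.eventually_le_const ha] with n hn
    push_cast
    have hn0 : (n : ℝ) + 1 ≠ 0 := by positivity
    have : ((n : ℝ) + 1 + 1) ^ 3 = (1 + 1 / ((n : ℝ) + 1)) ^ 3 * ((n : ℝ) + 1) ^ 3 := by
      field_simp
    rw [this]
    gcongr
  · exact tendsto_atTop_mono (fun n => (Nat.le_succ n).trans (Nat.le_self_pow three_ne_zero _))
      tendsto_id

end SecondMoment

/-! ### Laws of random orderings and chain events. -/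

namespace TotalOrdering

variable {α β : Type*}

theorem measurableSet_lt (a b : α) : MeasurableSet {o : TotalOrdering α | o.lt a b} :=
  MeasurableSpace.measurableSet_generateFrom ⟨a, b, rfl⟩

theorem ext_lt {o o' : TotalOrdering α} (h : ∀ a b, o.lt a b ↔ o'.lt a b) : o = o' := by
  obtain ⟨r, hr⟩ := o
  obtain ⟨r', hr'⟩ := o'
  obtain rfl : r = r' := funext fun a => funext fun b => propext (h a b)
  rfl

theorem lt_asymm (o : TotalOrdering α) {a b : α} (h : o.lt a b) : ¬ o.lt b a :=
  have := o.isTotal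
  asymm_of o.lt h

theorem lt_irrefl (o : TotalOrdering α) (a : α) : ¬ o.lt a a := fun h => o.lt_asymm h h

theorem lt_trans (o : TotalOrdering α) {a b c : α} (h : o.lt a b) (h' : o.lt b c) : o.lt a c :=
  have := o.isTotal
  trans_of o.lt h h'

theorem lt_or_lt (o : TotalOrdering α) {a b : α} (h : a ≠ b) : o.lt a b ∨ o.lt b a := by
  have := o.isTotal
  rcases trichotomous_of o.lt a b with h' | h' | h'
  · exact Or.inl h'
  · exact absurd h' h
  · exact Or.inr h'

/-- The ordering of `α` induced by an injection into an ordered type. -/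
def comap (f : α ↪ β) (o : TotalOrdering β) : TotalOrdering α where
  lt a b := o.lt (f a) (f b)
  isTotal :=
    { trichotomous := fun a b hab hba => by
        by_contra hne
        exact (o.lt_or_lt (f.injective.ne hne)).elim hab hba
      irrefl := fun a => o.lt_irrefl (f a)
      trans := fun _ _ _ => o.lt_trans }

theorem measurable_comap (f : α ↪ β) : Measurable (comap f) := by
  refine measurable_generateFrom ?_
  rintro _ ⟨a, b, rfl⟩
  exact measurableSet_lt (f a) (f b)

theorem measurableSet_chainEvent {k : ℕ} (x : Fin k → α) : MeasurableSet (chainEvent x) := by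
  have : chainEvent x = ⋂ (i : Fin k) (j : Fin k) (_ : i < j),
      {o : TotalOrdering α | o.lt (x i) (x j)} := by
    ext o
    simp [chainEvent]
  rw [this]
  exact MeasurableSet.iInter fun i => MeasurableSet.iInter fun j => MeasurableSet.iInter fun _ =>
    measurableSet_lt _ _

theorem comap_preimage_chainEvent (f : α ↪ β) {k : ℕ} (x : Fin k → α) :
    comap f ⁻¹' chainEvent x = chainEvent (f ∘ x) := rfl

theorem exists_mem_chainEvent (o : TotalOrdering α) {k : ℕ} {x : Fin k → α}
    (hx : Function.Injective x) : ∃ g : Equiv.Perm (Fin k), o ∈ chainEvent (x ∘ g) := by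
  classical
  have := o.isTotal
  let _ := linearOrderOfSTO o.lt
  refine ⟨Tuple.sort x, fun i j hij => ?_⟩
  have h : x (Tuple.sort x i) ≤ x (Tuple.sort x j) := Tuple.monotone_sort x hij.le
  exact h.lt_of_ne (hx.ne ((Tuple.sort x).injective.ne hij.ne))

theorem lt_iff_of_mem_chainEvent {o : TotalOrdering α} {k : ℕ} {x : Fin k → α}
    (h : o ∈ chainEvent x) (i j : Fin k) : o.lt (x i) (x j) ↔ i < j := by
  refine ⟨fun hij => ?_, h i j⟩
  by_contra hji
  rcases (not_lt.1 hji).lt_or_eq with h' | h'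
  · exact o.lt_asymm hij (h j i h')
  · exact o.lt_irrefl _ (h' ▸ hij)

/-- Two permutations that sort the same ordering differ by a strictly increasing bijection of `Fin
k`, which is the identity. -/
theorem pairwise_disjoint_chainEvent {k : ℕ} (x : Fin k → α) :
    Pairwise (Function.onFun Disjoint fun g : Equiv.Perm (Fin k) => chainEvent (x ∘ g)) := by
  intro g τ hne
  refine Set.disjoint_left.2 fun o hg hτ => hne ?_
  have key : ∀ i j, g.symm i < g.symm j ↔ τ.symm i < τ.symm j := by
    intro i j
    have h1 := lt_iff_of_mem_chainEvent hg (g.symm i) (g.symm j)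
    have h2 := lt_iff_of_mem_chainEvent hτ (τ.symm i) (τ.symm j)
    simp only [Function.comp_apply, Equiv.apply_symm_apply] at h1 h2
    exact h1.symm.trans h2
  have hmono : StrictMono (g.trans τ.symm) := fun i j hij => by
    simpa using (key (g i) (g j)).1 (by simpa using hij)
  have hid : g.trans τ.symm = Equiv.refl _ := by
    have := Subsingleton.elim (hmono.orderIsoOfSurjective _ (g.trans τ.symm).surjective)
      (OrderIso.refl (Fin k))
    ext1 i
    exact congrArg (fun e : Fin k ≃o Fin k => e i) this
  ext1 i
  have := congrArg (fun e => τ (e i)) hid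
  simpa using this

theorem iUnion_chainEvent {k : ℕ} {x : Fin k → α} (hx : Function.Injective x) :
    ⋃ g : Equiv.Perm (Fin k), chainEvent (x ∘ g) = Set.univ :=
  Set.eq_univ_of_forall fun o => Set.mem_iUnion.2 (o.exists_mem_chainEvent hx)

/-- A probability distribution on orderings is determined by the probabilities of the events
`x₁ < ⋯ < xₖ`. -/
theorem measure_ext {P Q : Measure (TotalOrdering α)} [IsProbabilityMeasure P]
    [IsProbabilityMeasure Q]
    (h : ∀ (k : ℕ) (x : Fin k → α), Function.Injective x → P (chainEvent x) = Q (chainEvent x)) :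
    P = Q := by
  classical
  set S : Set (Set (TotalOrdering α)) := {s | ∃ a b : α, s = {o | o.lt a b}} with hS
  refine ext_of_generate_finite (generatePiSystem S)
    (generateFrom_generatePiSystem_eq (g := S)).symm (isPiSystem_generatePiSystem S) ?_
    (by simp)
  -- A set of the π-system depends only on the ordering of a finite set `F`, so it is a disjoint
  -- union of chain events enumerating `F`.
  have key : ∀ s ∈ generatePiSystem S, ∃ F : Finset α,
      ∀ o o' : TotalOrdering α, (∀ a ∈ F, ∀ b ∈ F, o.lt a b ↔ o'.lt a b) → (o ∈ s ↔ o' ∈ s) := by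
    intro s hs
    induction hs with
    | base hs =>
      obtain ⟨a, b, rfl⟩ := hs
      exact ⟨{a, b}, fun o o' h => h a (by simp) b (by simp)⟩
    | inter _ _ _ ih1 ih2 =>
      obtain ⟨F, hF⟩ := ih1
      obtain ⟨F', hF'⟩ := ih2
      refine ⟨F ∪ F', fun o o' h => and_congr (hF o o' ?_) (hF' o o' ?_)⟩
      · exact fun a ha b hb => h a (Finset.mem_union_left _ ha) b (Finset.mem_union_left _ hb)
      · exact fun a ha b hb => h a (Finset.mem_union_right _ ha) b (Finset.mem_union_right _ hb)
  intro s hs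
  obtain ⟨F, hF⟩ := key s hs
  have hsm : MeasurableSet s := by
    have := MeasurableSpace.measurableSet_generateFrom hs
    rwa [generateFrom_generatePiSystem_eq] at this
  obtain ⟨k, ⟨e⟩⟩ : ∃ k, Nonempty (Fin k ≃ F) := ⟨F.card, ⟨F.equivFin.symm⟩⟩
  set x : Fin k → α := fun i => (e i : α) with hx
  have hxi : Function.Injective x := Subtype.val_injective.comp e.injective
  have hdecomp : s = ⋃ g : Equiv.Perm (Fin k), s ∩ chainEvent (x ∘ g) := by
    rw [← Set.inter_iUnion, iUnion_chainEvent hxi, Set.inter_univ]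
  have hdisj : Pairwise (Function.onFun Disjoint
      fun g : Equiv.Perm (Fin k) => s ∩ chainEvent (x ∘ g)) := fun g τ hne =>
    (pairwise_disjoint_chainEvent x hne).mono Set.inter_subset_right Set.inter_subset_right
  have hmeas : ∀ g : Equiv.Perm (Fin k), MeasurableSet (s ∩ chainEvent (x ∘ g)) := fun g =>
    hsm.inter (measurableSet_chainEvent _)
  rw [hdecomp, measure_iUnion hdisj hmeas, measure_iUnion hdisj hmeas]
  refine tsum_congr fun g => ?_
  by_cases hne : (s ∩ chainEvent (x ∘ g)).Nonempty
  · obtain ⟨o, hos, hog⟩ := hne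
    have : s ∩ chainEvent (x ∘ g) = chainEvent (x ∘ g) := by
      refine Set.inter_eq_right.2 fun o' ho' => (hF o o' fun a ha b hb => ?_).1 hos
      obtain ⟨i, hi⟩ : ∃ i, x (g i) = a := ⟨g.symm (e.symm ⟨a, ha⟩), by simp [hx]⟩
      obtain ⟨j, hj⟩ : ∃ j, x (g j) = b := ⟨g.symm (e.symm ⟨b, hb⟩), by simp [hx]⟩
      rw [← hi, ← hj]
      exact (lt_iff_of_mem_chainEvent hog i j).trans (lt_iff_of_mem_chainEvent ho' i j).symm
    rw [this]
    exact h k _ (hxi.comp g.injective)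
  · rw [Set.not_nonempty_iff_eq_empty.1 hne, measure_empty, measure_empty]

/-- The `k!` chain events on the entries of `x` partition the space and are equally likely. -/
theorem measure_chainEvent_of_exchangeable {P : Measure (TotalOrdering α)}
    [IsProbabilityMeasure P]
    (hP : ∀ (k : ℕ) (x : Fin k → α) (g : Equiv.Perm (Fin k)), Function.Injective x →
      P (chainEvent (x ∘ g)) = P (chainEvent x))
    {k : ℕ} {x : Fin k → α} (hx : Function.Injective x) :
    P (chainEvent x) = ((Nat.factorial k : ℕ) : ENNReal)⁻¹ := by
  have h1 : ∑' g : Equiv.Perm (Fin k), P (chainEvent (x ∘ g)) = 1 := by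
    rw [← measure_iUnion (pairwise_disjoint_chainEvent x) fun g => measurableSet_chainEvent _,
      iUnion_chainEvent hx, measure_univ]
  simp_rw [hP k x _ hx] at h1
  rw [tsum_fintype, Finset.sum_const, Finset.card_univ, Fintype.card_perm, Fintype.card_fin,
    nsmul_eq_mul, mul_comm] at h1
  exact ENNReal.eq_inv_of_mul_eq_one_left h1

theorem eq_of_exchangeable {P Q : Measure (TotalOrdering α)} [IsProbabilityMeasure P]
    [IsProbabilityMeasure Q]
    (hP : ∀ (k : ℕ) (x : Fin k → α) (g : Equiv.Perm (Fin k)), Function.Injective x →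
      P (chainEvent (x ∘ g)) = P (chainEvent x))
    (hQ : ∀ (k : ℕ) (x : Fin k → α) (g : Equiv.Perm (Fin k)), Function.Injective x →
      Q (chainEvent (x ∘ g)) = Q (chainEvent x)) : P = Q :=
  measure_ext fun _ _ hx => by
    rw [measure_chainEvent_of_exchangeable hP hx, measure_chainEvent_of_exchangeable hQ hx]

end TotalOrdering

/-! ### Invariance under automorphisms of the blow-up. -/

namespace IsConsistent

variable {α : Type*} {G : SimpleGraph α} {P : Measure (TotalOrdering α)}

theorem measure_chainEvent_comp (hP : IsConsistent G P) (f : G ≃g G) {k : ℕ} (x : Fin k → α) :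
    P (chainEvent x) = P (chainEvent (f ∘ x)) := by
  have hfin := Set.finite_range x
  let φ : G.induce (Set.range x) ≃g G.induce (f '' Set.range x) :=
    ⟨f.toEquiv.image _, by
      intro a b
      exact f.map_rel_iff⟩
  exact hP _ _ hfin (hfin.image f) φ k fun i => ⟨x i, i, rfl⟩

theorem map_comap [IsProbabilityMeasure P] (hP : IsConsistent G P) (f : G ≃g G) :
    P.map (TotalOrdering.comap f.toEquiv.toEmbedding) = P := by
  have hm := TotalOrdering.measurable_comap f.toEquiv.toEmbedding
  have := Measure.isProbabilityMeasure_map (μ := P) hm.aemeasurable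
  refine TotalOrdering.measure_ext fun k x _ => ?_
  rw [Measure.map_apply hm (TotalOrdering.measurableSet_chainEvent x),
    TotalOrdering.comap_preimage_chainEvent]
  exact (hP.measure_chainEvent_comp f x).symm

end IsConsistent

namespace Template

variable {V : Type*} (T : Template V)

/-- A permutation of the blow-up that maps every blob to itself is an automorphism. -/
def autOfPerm (f : Equiv.Perm (V × ℕ)) (hf : ∀ p, (f p).1 = p.1) : T.blowUp ≃g T.blowUp where
  toEquiv := f
  map_rel_iff' := by
    intro p q
    change ((f p).1 = (f q).1 ∧ (f p).1 ∈ T.full ∧ (f p).2 ≠ (f q).2) ∨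
      T.graph.Adj (f p).1 (f q).1 ↔ (p.1 = q.1 ∧ p.1 ∈ T.full ∧ p.2 ≠ q.2) ∨ T.graph.Adj p.1 q.1
    rw [hf, hf]
    refine or_congr_left (and_congr_right fun h => and_congr_right fun _ => not_congr ?_)
    have h1 : (f p).2 = (f q).2 ↔ f p = f q := by
      rw [Prod.ext_iff, hf, hf]
      exact ⟨fun h' => ⟨h, h'⟩, fun h' => h'.2⟩
    have h2 : p.2 = q.2 ↔ p = q := by
      rw [Prod.ext_iff]
      exact ⟨fun h' => ⟨h, h'⟩, fun h' => h'.2⟩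
    rw [h1, h2, f.injective.eq_iff]

end Template

/-! ### Uniformity on a single blob. -/

section Consistent

variable {V : Type*} {T : Template V} {P : Measure (TotalOrdering (V × ℕ))}
  [IsProbabilityMeasure P]

theorem IsConsistent.measurePreserving_swap [DecidableEq V] (hP : IsConsistent T.blowUp P) (v : V)
    (i j : ℕ) :
    MeasurePreserving (TotalOrdering.comap (Equiv.swap (v, i) (v, j)).toEmbedding) P P where
  measurable := TotalOrdering.measurable_comap _
  map_eq := by
    refine hP.map_comap (T.autOfPerm (Equiv.swap (v, i) (v, j)) fun p => ?_)
    rcases eq_or_ne p (v, i) with rfl | h1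
    · simp
    rcases eq_or_ne p (v, j) with rfl | h2
    · simp
    rw [Equiv.swap_apply_of_ne_of_ne h1 h2]

/-- The injection of the natural numbers onto the blob of `v`. -/
def blobEmbedding (v : V) : ℕ ↪ V × ℕ := ⟨fun i => (v, i), Prod.mk_right_injective v⟩

/-- Countably many i.i.d. uniform random variables are almost surely distinct. -/
theorem ae_injective_infinitePi (α : Type*) [Countable α] :
    ∀ᵐ X ∂(Measure.infinitePi fun _ : α => (volume : Measure I)), Function.Injective X := by
  have hties : ∀ a b : α, a ≠ b →
      ∀ᵐ X ∂(Measure.infinitePi fun _ : α => (volume : Measure I)), X a ≠ X b := by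
    intro a b hab
    have hmap : (Measure.infinitePi fun _ : α => (volume : Measure I)).map (fun X => (X a, X b))
        = (volume : Measure I).prod volume := Measure.infinitePi_map_eval_prod hab
    have hdiag : ((volume : Measure I).prod volume) {q | q.1 = q.2} = 0 := by
      rw [Measure.measure_prod_null (measurableSet_eq_fun measurable_fst measurable_snd)]
      refine ae_of_all _ fun t => ?_
      have : Prod.mk t ⁻¹' {q : I × I | q.1 = q.2} = {t} := by
        ext s
        simp [eq_comm]
      change volume (Prod.mk t ⁻¹' {q : I × I | q.1 = q.2}) = 0
      rw [this]
      simp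
    rw [← hmap, Measure.map_apply (by fun_prop)
      (measurableSet_eq_fun measurable_fst measurable_snd)] at hdiag
    exact measure_eq_zero_iff_ae_notMem.1 hdiag
  have hall : ∀ᵐ X ∂(Measure.infinitePi fun _ : α => (volume : Measure I)),
      ∀ a b : α, a ≠ b → X a ≠ X b :=
    ae_all_iff.2 fun a => ae_all_iff.2 fun b => by
      by_cases hab : a = b
      · exact ae_of_all _ fun _ h => absurd hab h
      · filter_upwards [hties a b hab] with X hX _ using hX
  filter_upwards [hall] with X hX a b hab
  by_contra hne
  exact hX a b hne hab

theorem uniformOrdering_chainEvent_comp {α : Type*} [Countable α] {k : ℕ} {x : Fin k → α}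
    (hx : Function.Injective x) (g : Equiv.Perm (Fin k)) :
    uniformOrdering α (chainEvent (x ∘ g)) = uniformOrdering α (chainEvent x) := by
  classical
  set μ : Measure (α → I) := Measure.infinitePi fun _ : α => (volume : Measure I)
  have hlaw : ∀ y : Fin k → α, uniformOrdering α (chainEvent y)
      = μ {X | ∀ i j : Fin k, i < j → (y i ≠ y j → X (y i) < X (y j)) ∧ y i ≠ y j} := by
    intro y
    unfold uniformOrdering
    rw [Measure.map_apply measurable_orderingOfValues (TotalOrdering.measurableSet_chainEvent y)]
    refine measure_congr ?_
    filter_upwards [ae_injective_infinitePi α] with X hX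
    refine propext (forall_congr' fun i => forall_congr' fun j => imp_congr_right fun hij => ?_)
    constructor
    · intro h
      have hne : y i ≠ y j := fun hh =>
        TotalOrdering.lt_irrefl (orderingOfValues X) (y j) (hh ▸ h)
      refine ⟨fun _ => ?_, hne⟩
      exact h.resolve_right fun h' => hne (hX h'.1)
    · exact fun h => Or.inl (h.1 h.2)
  have hperm : ∀ e : Equiv.Perm α, μ.map (fun X a => X (e a)) = μ := fun e =>
    Measure.map_infinitePi_infinitePi_of_inj e.injective
  set e : Equiv.Perm α := g.viaFintypeEmbedding ⟨x, hx⟩ with he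
  have hex : ∀ i, e (x i) = x (g i) := fun i =>
    Equiv.Perm.viaFintypeEmbedding_apply_image g ⟨x, hx⟩ i
  have hmeas : MeasurableSet {X : α → I | ∀ i j : Fin k, i < j →
      (x i ≠ x j → X (x i) < X (x j)) ∧ x i ≠ x j} := by
    measurability
  rw [hlaw, hlaw]
  conv_rhs => rw [← hperm e, Measure.map_apply (by fun_prop) hmeas]
  congr 1
  ext X
  refine forall_congr' fun i => forall_congr' fun j => imp_congr_right fun hij => ?_
  simp only [hex, Function.comp_apply, ne_eq, hx.eq_iff, g.injective.eq_iff]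

instance {α : Type*} : IsProbabilityMeasure (uniformOrdering α) :=
  Measure.isProbabilityMeasure_map measurable_orderingOfValues.aemeasurable

/-- A consistent random ordering is uniform on each blob. -/
theorem IsConsistent.map_comap_blobEmbedding (hP : IsConsistent T.blowUp P) (v : V) :
    P.map (TotalOrdering.comap (blobEmbedding v)) = uniformOrdering ℕ := by
  classical
  have hm := TotalOrdering.measurable_comap (blobEmbedding v)
  have := Measure.isProbabilityMeasure_map (μ := P) hm.aemeasurable
  refine TotalOrdering.eq_of_exchangeable (fun k x g hx => ?_)
    fun k x g hx => uniformOrdering_chainEvent_comp hx g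
  rw [Measure.map_apply hm (TotalOrdering.measurableSet_chainEvent _),
    Measure.map_apply hm (TotalOrdering.measurableSet_chainEvent _),
    TotalOrdering.comap_preimage_chainEvent, TotalOrdering.comap_preimage_chainEvent]
  have hy : Function.Injective (blobEmbedding v ∘ x) := (blobEmbedding v).injective.comp hx
  -- Extended by the identity, `g` preserves every blob and so is an automorphism.
  set e : Equiv.Perm (V × ℕ) := g.viaFintypeEmbedding ⟨_, hy⟩ with he
  have hex : e ∘ (blobEmbedding v ∘ x) = blobEmbedding v ∘ x ∘ g := funext fun i =>
    Equiv.Perm.viaFintypeEmbedding_apply_image g ⟨_, hy⟩ i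
  have hblob : ∀ p, (e p).1 = p.1 := by
    intro p
    by_cases hp : p ∈ Set.range (blobEmbedding v ∘ x)
    · obtain ⟨i, rfl⟩ := hp
      exact (congrArg Prod.fst (congrFun hex i)).trans rfl
    · rw [he, Equiv.Perm.viaFintypeEmbedding_apply_notMem_range _ _ hp]
  rw [← hex]
  exact (hP.measure_chainEvent_comp (T.autOfPerm e hblob) _).symm

end Consistent

/-- Ranks are limits, so they ignore the finitely many comparison vertices that a swap moves. -/
theorem tendsto_proportion_congr {s t : Set ℕ} {l : ℝ} (M : ℕ) (hst : ∀ k ≥ M, k ∈ s ↔ k ∈ t)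
    (h : Tendsto (proportion s) atTop (𝓝 l)) : Tendsto (proportion t) atTop (𝓝 l) := by
  have h0 : Tendsto (fun n : ℕ => (∑ k ∈ Finset.range M,
      (t.indicator (fun _ => (1 : ℝ)) k - s.indicator (fun _ => (1 : ℝ)) k)) / (n : ℝ))
      atTop (𝓝 0) := tendsto_const_nhds.div_atTop tendsto_natCast_atTop_atTop
  have h1 := h.add h0
  rw [add_zero] at h1
  refine h1.congr' ?_
  filter_upwards [eventually_ge_atTop M] with n hn
  have h2 : ∑ k ∈ Finset.range M,
      (t.indicator (fun _ => (1 : ℝ)) k - s.indicator (fun _ => (1 : ℝ)) k)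
      = ∑ k ∈ Finset.range n,
        (t.indicator (fun _ => (1 : ℝ)) k - s.indicator (fun _ => (1 : ℝ)) k) := by
    refine Finset.sum_subset (Finset.range_mono hn) fun k _ hk => ?_
    have := hst k (not_lt.1 (mt Finset.mem_range.2 hk))
    by_cases hks : k ∈ s
    · simp [hks, this.1 hks]
    · simp [hks, mt this.2 hks]
  rw [h2, Finset.sum_sub_distrib]
  unfold proportion
  rw [← add_div, add_sub_cancel]

/-! ### Ranks, and their values in the uniform ordering. -/

namespace TotalOrdering

variable {α : Type*}

/-- The rank of `p` in an ordering: the limiting proportion of terms of `c` that `p` exceeds. -/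
noncomputable def rank (c : ℕ → α) (p : α) (o : TotalOrdering α) : ℝ :=
  limUnder atTop (proportion {k | o.lt (c k) p})

theorem measurable_rank (c : ℕ → α) (p : α) : Measurable (rank c p) :=
  (StronglyMeasurable.limUnder fun n => (measurable_proportion
    (E := fun k => {o : TotalOrdering α | o.lt (c k) p})
    (fun k => measurableSet_lt (c k) p) n).stronglyMeasurable).measurable

theorem measurableSet_isEquidistributed_rank (c d : ℕ → α) :
    MeasurableSet {o : TotalOrdering α | IsEquidistributed fun i => o.rank c (d i)} := by
  have : {o : TotalOrdering α | IsEquidistributed fun i => o.rank c (d i)}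
      = ⋂ (q : ℚ) (_ : (q : ℝ) ∈ Set.Icc (0 : ℝ) 1),
        {o | Tendsto (fun n => proportion {i | o ∈ {o : TotalOrdering α | o.rank c (d i) ≤ q}} n)
          atTop (𝓝 (q : ℝ))} := by
    ext o
    simp only [Set.mem_iInter]
    exact ⟨fun h q hq => h q hq, fun h => isEquidistributed_of_rat h⟩
  rw [this]
  refine MeasurableSet.iInter fun q => MeasurableSet.iInter fun _ => ?_
  exact measurableSet_tendsto _ fun n => measurable_proportion
    (fun i => measurableSet_le (measurable_rank c (d i)) measurable_const) n

theorem rank_mono {o : TotalOrdering α} {c : ℕ → α} {l m : ℝ} {p q : α} (hpq : o.lt p q)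
    (hp : Tendsto (proportion {k | o.lt (c k) p}) atTop (𝓝 l))
    (hq : Tendsto (proportion {k | o.lt (c k) q}) atTop (𝓝 m)) : l ≤ m :=
  le_of_tendsto_of_tendsto' hp hq fun n => proportion_mono (fun _ h => o.lt_trans h hpq) n

/-- The tie-breaking rule only affects indices with `X (c k) = X p`, which equidistribution makes
negligible. -/
theorem tendsto_proportion_orderingOfValues {X : α → I} {c : ℕ → α}
    (hc : IsEquidistributed fun k => (X (c k) : ℝ)) (p : α) :
    Tendsto (proportion {k | (orderingOfValues X).lt (c k) p}) atTop (𝓝 (X p : ℝ)) := by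
  refine hc.tendsto_of_subset (X p).2 (fun k hk => Or.inl hk) ?_
  rintro k (h | ⟨h, -⟩)
  · exact h.le
  · exact h.le

end TotalOrdering

open TotalOrdering hiding comap

theorem ae_isEquidistributed_infinitePi {α : Type*} {c : ℕ → α} (hc : Function.Injective c) :
    ∀ᵐ X ∂(Measure.infinitePi fun _ : α => (volume : Measure I)),
      IsEquidistributed fun k => (X (c k) : ℝ) := by
  set μ : Measure (α → I) := Measure.infinitePi fun _ : α => (volume : Measure I)
  have hrat : ∀ᵐ X ∂μ, ∀ q : ℚ, (q : ℝ) ∈ Set.Icc (0 : ℝ) 1 →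
      Tendsto (proportion {k | (X (c k) : ℝ) ≤ q}) atTop (𝓝 (q : ℝ)) := by
    refine ae_all_iff.2 fun q => ?_
    by_cases hq : (q : ℝ) ∈ Set.Icc (0 : ℝ) 1
    · let f : I → ℝ := (Set.Iic (⟨q, hq⟩ : I)).indicator fun _ => 1
      have hf : Measurable f := measurable_const.indicator measurableSet_Iic
      have hid : ∀ i, IdentDistrib (fun X : α → I => f (X (c i))) (fun X => f (X (c 0))) μ μ := by
        intro i
        refine IdentDistrib.comp (u := f)
          ⟨(measurable_pi_apply _).aemeasurable, (measurable_pi_apply _).aemeasurable, ?_⟩ hf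
        exact (measurePreserving_eval_infinitePi (fun _ : α => (volume : Measure I)) (c i)).map_eq.trans
          (measurePreserving_eval_infinitePi (fun _ : α => (volume : Measure I)) (c 0)).map_eq.symm
      have hintf : Integrable f (volume : Measure I) :=
        (integrable_const 1).indicator measurableSet_Iic
      have hmp : MeasurePreserving (fun X : α → I => X (c 0)) μ volume :=
        measurePreserving_eval_infinitePi _ (c 0)
      have hint : Integrable (fun X : α → I => f (X (c 0))) μ := hmp.integrable_comp_of_integrable hintf
      have hind : iIndepFun (fun a (X : α → I) => f (X a)) μ := iIndepFun_infinitePi fun _ => hf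
      have hval : ∫ X, f (X (c 0)) ∂μ = q := by
        have h1 : ∫ X, f (X (c 0)) ∂μ = ∫ t, f t := by
          rw [← hmp.map_eq, integral_map hmp.aemeasurable hf.aestronglyMeasurable]
        have h2 : ∫ t, f t = (volume : Measure I).real (Set.Iic ⟨q, hq⟩) :=
          integral_indicator_one measurableSet_Iic
        rw [h1, h2, Measure.real, unitInterval.volume_Iic, ENNReal.toReal_ofReal hq.1]
      have hslln := strong_law_ae_real (fun i (X : α → I) => f (X (c i))) hint
        (fun i j hij => hind.indepFun (hc.ne hij)) hid
      rw [hval] at hslln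
      filter_upwards [hslln] with X hX _
      exact hX
    · exact ae_of_all _ fun _ h => absurd h hq
  filter_upwards [hrat] with X hX using isEquidistributed_of_rat hX

theorem ae_isEquidistributed_rank_uniformOrdering {α : Type*} {c d : ℕ → α}
    (hc : Function.Injective c) (hd : Function.Injective d) :
    ∀ᵐ o ∂(uniformOrdering α), IsEquidistributed fun i => o.rank c (d i) := by
  unfold uniformOrdering
  rw [ae_map_iff measurable_orderingOfValues.aemeasurable
    (measurableSet_isEquidistributed_rank c d)]
  filter_upwards [ae_isEquidistributed_infinitePi hc, ae_isEquidistributed_infinitePi hd]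
    with X hXc hXd
  have : (fun i => (orderingOfValues X).rank c (d i)) = fun i => (X (d i) : ℝ) :=
    funext fun i => (tendsto_proportion_orderingOfValues hXc (d i)).limUnder_eq
  rw [this]
  exact hXd

/-! ### Almost sure existence of the limits. -/

namespace IsConsistent

variable {V : Type*} {T : Template V} {P : Measure (TotalOrdering (V × ℕ))}
  [IsProbabilityMeasure P]

/-- The limits defining the rank variables exist almost surely. -/
theorem ae_tendsto_rankVar (hP : IsConsistent T.blowUp P) (w : V) (p : V × ℕ) :
    ∀ᵐ o ∂P, Tendsto (proportion {k | o.lt (w, k) p}) atTop (𝓝 (rankVar w p o)) := by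
  classical
  -- Beyond index `N` the vertices `(w, N + k)` differ from `p`, so swapping two of them fixes `p`.
  obtain ⟨N, hN⟩ : ∃ N, p.2 < N := ⟨_, Nat.lt_succ_self _⟩
  set E : ℕ → Set (TotalOrdering (V × ℕ)) := fun k => {o | o.lt (w, N + k) p} with hE
  have hEm : ∀ k, MeasurableSet (E k) := fun k => measurableSet_lt _ _
  have hne : ∀ k, p ≠ (w, N + k) := by
    intro k h
    have : p.2 = N + k := congrArg Prod.snd h
    omega
  have hswap : ∀ i j, MeasurePreserving (TotalOrdering.comap (Equiv.swap (w, N + i) (w, N + j)).toEmbedding)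
      P P := fun i j => hP.measurePreserving_swap w (N + i) (N + j)
  have hpre : ∀ i j k, TotalOrdering.comap (Equiv.swap (w, N + i) (w, N + j)).toEmbedding ⁻¹' E k
      = E (Equiv.swap i j k) := by
    intro i j k
    have h1 : Equiv.swap (w, N + i) (w, N + j) p = p :=
      Equiv.swap_apply_of_ne_of_ne (hne i) (hne j)
    have h2 : Equiv.swap (w, N + i) (w, N + j) (w, N + k) = (w, N + Equiv.swap i j k) := by
      have hinj : Function.Injective fun m : ℕ => (w, N + m) := fun a b hab => by
        simpa using hab
      exact hinj.swap_apply i j k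
    ext o
    change o.lt (Equiv.swap (w, N + i) (w, N + j) (w, N + k))
      (Equiv.swap (w, N + i) (w, N + j) p) ↔ _
    rw [h1, h2]
    rfl
  have hd : ∀ i, P.real (E i) = P.real (E 0) := by
    intro i
    rw [← (hswap 0 i).measureReal_preimage (hEm 0).nullMeasurableSet, hpre, Equiv.swap_apply_left]
  have hstep : ∀ a b i j, P.real (E (Equiv.swap a b i) ∩ E (Equiv.swap a b j))
      = P.real (E i ∩ E j) := by
    intro a b i j
    rw [← (hswap a b).measureReal_preimage ((hEm i).inter (hEm j)).nullMeasurableSet,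
      Set.preimage_inter, hpre, hpre]
  -- Two swaps carry `(i, j)` to `(0, 1)`: the first sends `i` to `0`, the second sends the image of
  -- `j` to `1` and fixes `0`.
  have hc : ∀ i j, i ≠ j → P.real (E i ∩ E j) = P.real (E 0 ∩ E 1) := by
    intro i j hij
    have h1 : Equiv.swap 1 (Equiv.swap 0 i j) 0 = 0 := by
      refine Equiv.swap_apply_of_ne_of_ne zero_ne_one fun h => hij ?_
      have := congrArg (Equiv.swap 0 i) h
      simpa using this
    have h2 := hstep 0 i 0 (Equiv.swap 0 i j)
    have h3 := hstep 1 (Equiv.swap 0 i j) 0 1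
    rw [h1, Equiv.swap_apply_left] at h3
    rw [Equiv.swap_apply_left, Equiv.swap_apply_self] at h2
    exact h2.trans h3
  filter_upwards [ae_exists_tendsto_proportion hEm hc hd] with o ho
  obtain ⟨l, hl⟩ := ho
  have h : Tendsto (proportion {k | o.lt (w, k) p}) atTop (𝓝 l) :=
    tendsto_proportion_of_shift (s := {k | o.lt (w, k) p}) N hl
  exact tendsto_nhds_limUnder ⟨l, h⟩

theorem ae_isEquidistributed_rankVar (hP : IsConsistent T.blowUp P) (v : V) :
    ∀ᵐ o ∂P, IsEquidistributed fun i => rankVar v (v, i) o := by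
  have h := ae_isEquidistributed_rank_uniformOrdering (α := ℕ) Function.injective_id
    Function.injective_id
  rw [← hP.map_comap_blobEmbedding v] at h
  exact ae_of_ae_map (measurable_comap _).aemeasurable h

/-- The limiting empirical distribution functions of the rank variables exist almost surely. -/
theorem ae_isUnitCDF_rankCDF [Countable V] (hP : IsConsistent T.blowUp P) (w v : V) :
    ∀ᵐ o ∂P, IsUnitCDF (rankCDF w v o) ∧ ∀ x ∈ Set.Icc (0 : ℝ) 1,
      Tendsto (proportion {i | rankVar w (v, i) o ≤ x}) atTop (𝓝 (rankCDF w v o x)) := by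
  filter_upwards [ae_all_iff.2 fun i => hP.ae_tendsto_rankVar w (v, i),
    ae_all_iff.2 fun i => hP.ae_tendsto_rankVar v (v, i), hP.ae_isEquidistributed_rankVar v]
    with o hw hv heq
  -- Ranks with respect to the blobs of `v` and of `w` both follow the ordering, so a larger
  -- `v`-rank forces a `w`-rank at least as large.
  refine heq.isUnitCDF (fun i => limit_proportion_mem_Icc (hv i))
    (fun i => (limit_proportion_mem_Icc (hw i)).2) fun i j hij => rank_mono ?_ (hw i) (hw j)
  have hne : (v, i) ≠ (v, j) := by
    intro h
    rw [h] at hij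
    exact lt_irrefl _ hij
  exact (o.lt_or_lt hne).resolve_right fun h => (rank_mono h (hv j) (hv i)).not_gt hij

/-- The rank variables of a consistent ordering transform with the vertices under a swap. -/
theorem ae_rankVar_comap_swap [DecidableEq V] (hP : IsConsistent T.blowUp P) (u v : V) (i j : ℕ)
    (p : V × ℕ) :
    ∀ᵐ o ∂P, rankVar u p (TotalOrdering.comap (Equiv.swap (v, i) (v, j)).toEmbedding o)
      = rankVar u (Equiv.swap (v, i) (v, j) p) o := by
  filter_upwards [hP.ae_tendsto_rankVar u (Equiv.swap (v, i) (v, j) p)] with o ho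
  refine Tendsto.limUnder_eq (tendsto_proportion_congr (i + j + 1) (fun k hk => ?_) ho)
  have h : Equiv.swap (v, i) (v, j) (u, k) = (u, k) := by
    refine Equiv.swap_apply_of_ne_of_ne ?_ ?_ <;>
    · intro h
      have := congrArg Prod.snd h
      simp only at this
      omega
  change o.lt (u, k) _ ↔ o.lt (Equiv.swap (v, i) (v, j) (u, k)) _
  rw [h]
  rfl

end IsConsistent

/-! ### Deterministic empirical limits force i.i.d. ranks. -/

/-- Real random variables whose joint distribution function is a product are independent. -/
theorem iIndepFun_of_measureReal_iInter_le {Ω ι : Type*} [MeasurableSpace Ω] {μ : Measure Ω}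
    [IsProbabilityMeasure μ] {X : ι → Ω → ℝ} (hX : ∀ i, Measurable (X i)) (G : ℝ → ℝ)
    (h : ∀ (s : Finset ι) (x : ι → ℝ), μ.real (⋂ i ∈ s, {ω | X i ω ≤ x i}) = ∏ i ∈ s, G (x i)) :
    iIndepFun X μ := by
  rw [iIndepFun_iff_iIndep]
  refine iIndepSets.iIndep (fun i => (hX i).comap_le)
    (fun i => {s | ∃ t ∈ Set.range Set.Iic, X i ⁻¹' t = s}) (fun i => isPiSystem_Iic.comap (X i))
    (fun i => ?_) ?_
  · exact (congrArg (MeasurableSpace.comap (X i)) ((BorelSpace.measurable_eq (α := ℝ)).trans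
      (borel_eq_generateFrom_Iic ℝ))).trans MeasurableSpace.comap_generateFrom
  · rw [iIndepSets_iff]
    intro s f hf
    have hx : ∀ i, ∃ x : ℝ, i ∈ s → f i = {ω | X i ω ≤ x} := by
      intro i
      by_cases hi : i ∈ s
      · obtain ⟨_, ⟨x, rfl⟩, hx⟩ := hf i hi
        exact ⟨x, fun _ => hx.symm⟩
      · exact ⟨0, fun h => absurd h hi⟩
    choose x hx using hx
    have h1 : ⋂ i ∈ s, f i = ⋂ i ∈ s, {ω | X i ω ≤ x i} :=
      Set.iInter₂_congr fun i hi => hx i hi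
    -- The singleton case of `h` identifies `G` as the common marginal distribution function.
    have h2 : ∀ i ∈ s, μ.real (f i) = G (x i) := by
      intro i hi
      rw [hx i hi]
      simpa using h {i} x
    rw [← ENNReal.toReal_eq_toReal_iff' (measure_ne_top _ _)
      (ENNReal.prod_ne_top fun i _ => measure_ne_top _ _), ENNReal.toReal_prod]
    change μ.real _ = ∏ i ∈ s, μ.real (f i)
    rw [h1, h, Finset.prod_congr rfl h2]

theorem isUniform_of_measureReal_le {Ω : Type*} [MeasurableSpace Ω] {μ : Measure Ω}
    [IsProbabilityMeasure μ] {X : Ω → ℝ} (hX : Measurable X)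
    (h : ∀ x, μ.real {ω | X ω ≤ x} = max 0 (min 1 x)) :
    pdf.IsUniform X (Set.Icc (0 : ℝ) 1) μ volume := by
  have := Measure.isProbabilityMeasure_map (μ := μ) hX.aemeasurable
  refine Measure.ext_of_Iic _ _ fun x => ?_
  have h1 : Set.Icc (0 : ℝ) 1 ∩ Set.Iic x = Set.Icc 0 (min 1 x) := by
    ext y
    simp [and_assoc]
  rw [cond_apply measurableSet_Icc, h1, Real.volume_Icc, Real.volume_Icc,
    Measure.map_apply hX measurableSet_Iic]
  have h2 : μ (X ⁻¹' Set.Iic x) = ENNReal.ofReal (max 0 (min 1 x)) := by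
    rw [← h x, ofReal_measureReal]
    rfl
  rw [h2]
  simp

namespace IsConsistent

variable {V : Type*} {T : Template V} {P : Measure (TotalOrdering (V × ℕ))}
  [IsProbabilityMeasure P] {u : V} {G : ℝ → ℝ}

/-- If the limiting empirical distribution functions of the rank variables of all blobs are the
deterministic function `G`, then the joint distribution function is a product. -/
theorem measureReal_iInter_rankVar_le (hP : IsConsistent T.blowUp P)
    (hG : ∀ v x, ∀ᵐ o ∂P, Tendsto (proportion {i | rankVar u (v, i) o ≤ x}) atTop (𝓝 (G x)))
    (s : Finset (V × ℕ)) (x : V × ℕ → ℝ) :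
    P.real (⋂ p ∈ s, {o | rankVar u p o ≤ x p}) = ∏ p ∈ s, G (x p) := by
  classical
  have hmeas : ∀ p y, MeasurableSet {o : TotalOrdering (V × ℕ) | rankVar u p o ≤ y} :=
    fun p y => measurableSet_le (measurable_rank (fun k => (u, k)) p) measurable_const
  induction s using Finset.induction_on with
  | empty => simp
  | insert p s hps ih =>
    obtain ⟨v, i⟩ := p
    set B : Set (TotalOrdering (V × ℕ)) := ⋂ p ∈ s, {o | rankVar u p o ≤ x p} with hB
    have hBm : MeasurableSet B := s.measurableSet_biInter fun p _ => hmeas p _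
    set y := x (v, i) with hy
    set E : ℕ → Set (TotalOrdering (V × ℕ)) := fun k => {o | rankVar u (v, k) o ≤ y} with hE
    obtain ⟨N, hN⟩ : ∃ N, ∀ k ≥ N, (v, k) ∉ s := by
      obtain ⟨N, hN⟩ := (s.image Prod.snd).bddAbove
      refine ⟨N + 1, fun k hk hks => ?_⟩
      have : k ≤ N := hN (Finset.mem_coe.2 (Finset.mem_image_of_mem Prod.snd hks))
      omega
    -- The swap of `v_i` and `v_k` moves no vertex of `s`, so it preserves `B` up to a null set and
    -- exchanges `E k` with `E i`.
    have hconst : ∀ k ≥ N, P.real (B ∩ E k) = P.real (B ∩ E i) := by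
      intro k hk
      have hmp := hP.measurePreserving_swap v i k
      rw [← hmp.measureReal_preimage (hBm.inter (hmeas _ _)).nullMeasurableSet]
      refine measureReal_congr ?_
      have hall : ∀ᵐ o ∂P, ∀ p ∈ insert (v, k) s,
          rankVar u p (TotalOrdering.comap (Equiv.swap (v, i) (v, k)).toEmbedding o)
            = rankVar u (Equiv.swap (v, i) (v, k) p) o :=
        (ae_ball_iff (Finset.countable_toSet _)).2 fun p _ => hP.ae_rankVar_comap_swap u v i k p
      filter_upwards [hall] with o ho
      have hs : ∀ p ∈ s, rankVar u p (TotalOrdering.comap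
          (Equiv.swap (v, i) (v, k)).toEmbedding o) = rankVar u p o := by
        intro p hp
        rw [ho p (Finset.mem_insert_of_mem hp), Equiv.swap_apply_of_ne_of_ne]
        · exact fun h => hps (h ▸ hp)
        · exact fun h => hN k hk (h ▸ hp)
      have hk' := ho (v, k) (Finset.mem_insert_self _ _)
      rw [Equiv.swap_apply_right] at hk'
      have hiff : TotalOrdering.comap (Equiv.swap (v, i) (v, k)).toEmbedding o ∈ B ∩ E k
          ↔ o ∈ B ∩ E i := by
        simp only [hB, hE, Set.mem_inter_iff, Set.mem_iInter, Set.mem_ofPred_eq]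
        rw [hk']
        exact and_congr_left fun _ => forall₂_congr fun p hp => by rw [hs p hp]
      exact propext hiff
    -- The integral over `B` of the frequency of the `E k` has two limits: this one by symmetry, and
    -- `P(B) * G y` by dominated convergence in `hlim2`. Equating them gives the induction step.
    have hlim1 : Tendsto (fun n => ∫ o, B.indicator (fun o => proportion {k | o ∈ E k} n) o ∂P)
        atTop (𝓝 (P.real (B ∩ E i))) := by
      have hev : Tendsto (fun k => P.real (B ∩ E k)) atTop (𝓝 (P.real (B ∩ E i))) :=
        tendsto_const_nhds.congr' (by
          filter_upwards [eventually_ge_atTop N] with k hk using (hconst k hk).symm)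
      refine hev.cesaro.congr fun n => ?_
      have h1 : ∀ o, B.indicator (fun o => proportion {k | o ∈ E k} n) o
          = (n : ℝ)⁻¹ * ∑ k ∈ Finset.range n, (B ∩ E k).indicator (fun _ => (1 : ℝ)) o := by
        intro o
        by_cases ho : o ∈ B
        · rw [Set.indicator_of_mem ho, proportion_eq_sum_indicator, div_eq_inv_mul]
          congr 1
          refine Finset.sum_congr rfl fun k _ => ?_
          rw [← Set.indicator_indicator, Set.indicator_of_mem ho]
        · rw [Set.indicator_of_notMem ho]
          simp [ho]
      simp_rw [h1]
      rw [integral_const_mul, integral_finsetSum _ fun k _ =>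
        (integrable_const _).indicator (hBm.inter (hmeas _ _))]
      congr 1
      exact Finset.sum_congr rfl fun k _ =>
        (integral_indicator_one (hBm.inter (hmeas _ _))).symm
    have hlim2 : Tendsto (fun n => ∫ o, B.indicator (fun o => proportion {k | o ∈ E k} n) o ∂P)
        atTop (𝓝 (∫ o, B.indicator (fun _ => G y) o ∂P)) := by
      refine tendsto_integral_of_dominated_convergence (fun _ => 1) (fun n => ?_)
        (integrable_const _) (fun n => ae_of_all _ fun o => ?_) ?_
      · exact ((measurable_proportion (fun k => hmeas (v, k) y) n).indicator
          hBm).aestronglyMeasurable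
      · rw [Real.norm_of_nonneg (Set.indicator_nonneg (fun _ _ => proportion_nonneg _ _) _)]
        exact Set.indicator_le' (fun _ _ => proportion_le_one _ _) (fun _ _ => zero_le_one) o
      · filter_upwards [hG v y] with o ho
        by_cases hoB : o ∈ B
        · simp only [Set.indicator_of_mem hoB]
          exact ho
        · simp only [Set.indicator_of_notMem hoB]
          exact tendsto_const_nhds
    have hfin := tendsto_nhds_unique hlim1 hlim2
    rw [integral_indicator_const _ hBm, ih, smul_eq_mul] at hfin
    rw [Finset.prod_insert hps, Finset.set_biInter_insert, Set.inter_comm, mul_comm]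
    exact hfin

/-- If the limiting empirical distribution functions of the rank variables of all blobs are those
of the uniform distribution, then the rank variables are i.i.d. and uniform. -/
theorem iIndepFun_rankVar [Countable V] (hP : IsConsistent T.blowUp P)
    (h : ∀ v : V, ∀ᵐ o ∂P, ∀ x ∈ Set.Icc (0 : ℝ) 1, rankCDF u v o x = x) :
    iIndepFun (fun (p : V × ℕ) o => rankVar u p o) P ∧
      ∀ p : V × ℕ, pdf.IsUniform (rankVar u p) (Set.Icc (0 : ℝ) 1) P volume := by
  have hmeas : ∀ p : V × ℕ, Measurable (rankVar u p) := fun p =>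
    measurable_rank (fun k => (u, k)) p
  -- The clamp extends the uniform distribution function to all real `x`, as the product formula
  -- requires.
  have hG : ∀ v x, ∀ᵐ o ∂P,
      Tendsto (proportion {i | rankVar u (v, i) o ≤ x}) atTop (𝓝 (max 0 (min 1 x))) := by
    intro v x
    filter_upwards [h v, hP.ae_isUnitCDF_rankCDF u v,
      ae_all_iff.2 fun i => hP.ae_tendsto_rankVar u (v, i)] with o ho hlim hr
    have hr' := fun i => limit_proportion_mem_Icc (hr i)
    rcases lt_or_ge x 0 with hx0 | hx0
    · have hempty : {i | rankVar u (v, i) o ≤ x} = ∅ :=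
        Set.eq_empty_of_forall_notMem fun i hi => (hx0.trans_le (hr' i).1).not_ge hi
      rw [hempty, max_eq_left ((min_le_right 1 x).trans hx0.le)]
      exact tendsto_proportion_empty
    rcases lt_or_ge 1 x with hx1 | hx1
    · have huniv : {i | rankVar u (v, i) o ≤ x} = Set.univ :=
        Set.eq_univ_of_forall fun i => (hr' i).2.trans hx1.le
      rw [huniv, min_eq_left hx1.le, max_eq_right zero_le_one]
      exact tendsto_proportion_univ
    · rw [min_eq_right hx1, max_eq_right hx0]
      have := hlim.2 x ⟨hx0, hx1⟩
      rwa [ho x ⟨hx0, hx1⟩] at this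
  have hjoint := hP.measureReal_iInter_rankVar_le hG
  refine ⟨iIndepFun_of_measureReal_iInter_le hmeas
    (fun x => max 0 (min 1 x)) hjoint, fun p =>
    isUniform_of_measureReal_le (hmeas p) fun x => ?_⟩
  simpa using hjoint {p} fun _ => x

/-! ### Recovering the ordering from its ranks. -/

/-- If the rank variables are i.i.d. and uniform, then the ordering is uniform. -/
theorem eq_uniformOrdering [Countable V] (hP : IsConsistent T.blowUp P)
    (hind : iIndepFun (fun (p : V × ℕ) o => rankVar u p o) P)
    (hunif : ∀ p : V × ℕ, pdf.IsUniform (rankVar u p) (Set.Icc (0 : ℝ) 1) P volume) :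
    P = uniformOrdering (V × ℕ) := by
  have hmeas : ∀ p : V × ℕ, Measurable (rankVar u p) := fun p =>
    measurable_rank (fun k => (u, k)) p
  let π : ℝ → I := Set.projIcc 0 1 zero_le_one
  have hπ : Measurable π := continuous_projIcc.measurable
  -- The ranks are real-valued and lie in `[0,1]` only almost surely, hence the projection.
  let Z : TotalOrdering (V × ℕ) → V × ℕ → I := fun o p => π (rankVar u p o)
  have hZp : ∀ p, Measurable fun o => Z o p := fun p => hπ.comp (hmeas p)
  have hZ : Measurable Z := measurable_pi_iff.2 hZp
  have hlaw : ∀ p, P.map (fun o => Z o p) = (volume : Measure I) := by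
    intro p
    have h1 : P.map (rankVar u p) = (volume : Measure I).map ((↑) : I → ℝ) := by
      rw [unitInterval.measurePreserving_coe.map_eq]
      refine (hunif p).trans ?_
      rw [ProbabilityTheory.cond, Real.volume_Icc]
      simp
    have h2 : P.map (fun o => Z o p) = (P.map (rankVar u p)).map π :=
      (Measure.map_map hπ (hmeas p)).symm
    have h3 : π ∘ ((↑) : I → ℝ) = id := funext fun t => Set.projIcc_val zero_le_one t
    rw [h2, h1, Measure.map_map hπ measurable_subtype_coe, h3, Measure.map_id]
  have hZlaw : P.map Z = Measure.infinitePi fun _ : V × ℕ => (volume : Measure I) := by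
    have hindZ : iIndepFun (fun p o => Z o p) P := hind.comp (fun _ => π) fun _ => hπ
    have := (iIndepFun_iff_map_fun_eq_infinitePi_map hZp).1 hindZ
    simp_rw [hlaw] at this
    exact this
  have hinj : ∀ᵐ o ∂P, Function.Injective (Z o) := by
    have := ae_injective_infinitePi (V × ℕ)
    rw [← hZlaw] at this
    exact ae_of_ae_map hZ.aemeasurable this
  have hae : ∀ᵐ o ∂P, orderingOfValues (Z o) = o := by
    filter_upwards [hinj, ae_all_iff.2 fun p => hP.ae_tendsto_rankVar u p] with o hoinj hlim
    -- Ranks are only weakly monotone along `o`; injectivity of `Z o` makes the inequality strict.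
    -- One implication suffices, as both orderings are total.
    have hlt : ∀ a b, o.lt a b → (orderingOfValues (Z o)).lt a b := by
      intro a b hab
      have hne : a ≠ b := fun h => o.lt_irrefl b (h ▸ hab)
      have hle : Z o a ≤ Z o b :=
        Set.monotone_projIcc zero_le_one (rank_mono hab (hlim a) (hlim b))
      exact Or.inl (hle.lt_of_ne (hoinj.ne hne))
    refine ext_lt fun a b => ⟨fun hab => ?_, hlt a b⟩
    have hne : a ≠ b := fun h => TotalOrdering.lt_irrefl _ b (h ▸ hab)
    exact (o.lt_or_lt hne).resolve_right fun h => TotalOrdering.lt_asymm _ hab (hlt b a h)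
  unfold uniformOrdering
  rw [← hZlaw, Measure.map_map measurable_orderingOfValues hZ]
  have : P.map (orderingOfValues ∘ Z) = P.map id := Measure.map_congr hae
  rw [this, Measure.map_id]

end IsConsistent

/-- The limiting empirical distribution functions of a uniform ordering are uniform. -/
theorem ae_rankCDF_uniformOrdering {V : Type*} (w v : V) :
    ∀ᵐ o ∂(uniformOrdering (V × ℕ)), ∀ x ∈ Set.Icc (0 : ℝ) 1, rankCDF w v o x = x := by
  filter_upwards [ae_isEquidistributed_rank_uniformOrdering (blobEmbedding w).injective
    (blobEmbedding v).injective] with o ho x hx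
  exact (ho x hx).limUnder_eq

theorem theorem3p6 {V : Type*} [Finite V] (T : Template V)
    (P : Measure (TotalOrdering (V × ℕ))) [IsProbabilityMeasure P]
    (hP : IsConsistent T.blowUp P) (u : V) :
    -- the limits defining `V_{w,p}` and `F_{w,v}` exist almost surely
    (∀ (w : V) (p : V × ℕ), ∀ᵐ o ∂P,
      Tendsto (proportion {k | o.lt (w, k) p}) atTop (𝓝 (rankVar w p o))) ∧
    (∀ w v : V, ∀ᵐ o ∂P, IsUnitCDF (rankCDF w v o) ∧ ∀ x ∈ Set.Icc (0 : ℝ) 1,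
      Tendsto (proportion {i | rankVar w (v, i) o ≤ x}) atTop (𝓝 (rankCDF w v o x))) ∧
    -- the equivalences, where the last item is stated for the fixed `u` and for all pairs
    List.TFAE [
      P = uniformOrdering (V × ℕ),
      iIndepFun (fun (p : V × ℕ) o => rankVar u p o) P ∧
        ∀ p : V × ℕ, pdf.IsUniform (rankVar u p) (Set.Icc (0 : ℝ) 1) P volume,
      ∀ v : V, ∀ᵐ o ∂P, ∀ x ∈ Set.Icc (0 : ℝ) 1, rankCDF u v o x = x,
      ∀ w v : V, ∀ᵐ o ∂P, ∀ x ∈ Set.Icc (0 : ℝ) 1, rankCDF w v o x = x] := by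
  refine ⟨fun w p => hP.ae_tendsto_rankVar w p, fun w v => hP.ae_isUnitCDF_rankCDF w v, ?_⟩
  tfae_have 1 → 4 := by
    rintro rfl w v
    exact ae_rankCDF_uniformOrdering w v
  tfae_have 4 → 3 := fun h v => h u v
  tfae_have 3 → 2 := hP.iIndepFun_rankVar
  tfae_have 2 → 1 := fun h => hP.eq_uniformOrdering h.1 h.2
  tfae_finish
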